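/- Let $n\ge 2$. By a convex polyhedron in $\mathbb{R}^n$ we mean a convex set whose intersection with every bounded convex polyhedron (the convex hull of a finite set) is again a bounded convex polyhedron; in particular, it may be unbounded, and every finite intersection of closed half-spaces is an example. It is called integer if all its vertices lie in $\mathbb{Z}^n$. For an $(n-1)$-dimensional set $F\subset\mathbb{R}^n$, the integer distance $\rho_{\mathrm{int}}(F,\boldsymbol 0)$ from $F$ to the origin is the index in $\mathbb{Z}^n$ of the smallest sublattice of $\mathbb{Z}^n$ containing $\mathbb{Z}^n\cap\operatorname{aff}(F)$. Theorem. Let $P\subset\mathbb{R}^n$ be an $n$-dimensional integer convex polyhedron not containing $\boldsymbol 0$. Let $\mathbf v$ be a vertex of $P$ lying in the interior of $\operatorname{conv}(P\cup\{\boldsymbol 0\})$, and let $\mathbf v$ be incident to exactly $m$ edges of $P$, parallel to the primitive vectors $\mathbf r_1,\dots,\mathbf r_m$ of $\mathbb{Z}^n$ (for bounded edges such vectors always exist; an unbounded edge at $\mathbf v$ is required to have a rational direction). Put $$\det \mathrm{St}_{\mathbf v}=\sum_{1\le i_1<\dots<i_n\le m}|\det(\mathbf r_{i_1},\dots,\mathbf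 r_{i_n})|.$$ Let $F$ be an $(n-1)$-dimensional face of $P$ containing $\mathbf v$. Suppose that $$\bigl(\mathbb{Z}^n\cap\operatorname{conv}(P\cup\{\boldsymbol 0\})\bigr)\setminus P=\{\boldsymbol 0\}.$$ Then $\rho_{\mathrm{int}}(F,\boldsymbol 0)$ is finite and $$\rho_{\mathrm{int}}(F,\boldsymbol 0)<(nm)^{4\cdot n!}\,\det \mathrm{St}_{\mathbf v}.$$ -/

import Mathlib

/-- The point of `ℝⁿ` with the given integer coordinates. -/
def intPt {n : ℕ} (z : Fin n → ℤ) : Fin n → ℝ := fun i => (z i : ℝ)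

/-- The lattice `ℤⁿ` as a subset of `ℝⁿ`. -/
def intLattice (n : ℕ) : Set (Fin n → ℝ) := Set.range (intPt (n := n))

/-- The dimension of (the affine hull of) a subset of `ℝⁿ`. -/
noncomputable def affDim {n : ℕ} (S : Set (Fin n → ℝ)) : ℕ :=
  Module.finrank ℝ (vectorSpan ℝ S)

/-- A convex polyhedron in the generalized sense: a convex set whose intersection with every
bounded convex polyhedron (the convex hull of a finite set) is again such a polyhedron.
Finite intersections of closed half-spaces are examples, bounded or not. -/
def IsConvexPolyhedron {n : ℕ} (P : Set (Fin n → ℝ)) : Prop :=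
  Convex ℝ P ∧
    ∀ T : Finset (Fin n → ℝ), ∃ S : Finset (Fin n → ℝ),
      P ∩ convexHull ℝ (T : Set (Fin n → ℝ)) = convexHull ℝ (S : Set (Fin n → ℝ))

/-- `F` is a `k`-dimensional face of `P`: a nonempty set of dimension `k` which is the set of all
points of `P` at which some linear functional attains its maximum over `P`. -/
def IsFaceOfDim {n : ℕ} (P F : Set (Fin n → ℝ)) (k : ℕ) : Prop :=
  F.Nonempty ∧ IsExposed ℝ P F ∧ affDim F = k

/-- `v` is a vertex of `P`. -/
def IsVertexOf {n : ℕ} (P : Set (Fin n → ℝ)) (v : Fin n → ℝ) : Prop :=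
  IsFaceOfDim P {v} 0

/-- An integer convex polyhedron: all its vertices are lattice points. -/
def IsIntegerConvexPolyhedron {n : ℕ} (P : Set (Fin n → ℝ)) : Prop :=
  IsConvexPolyhedron P ∧ ∀ v, IsVertexOf P v → v ∈ intLattice n

/-- The set of all edges of `P` incident to `v`. -/
def edgesAt {n : ℕ} (P : Set (Fin n → ℝ)) (v : Fin n → ℝ) : Set (Set (Fin n → ℝ)) :=
  {E | IsFaceOfDim P E 1 ∧ v ∈ E}

/-- A primitive vector of `ℤⁿ`: its coordinates have greatest common divisor `1`. -/
def IsPrimitiveVec {n : ℕ} (r : Fin n → ℤ) : Prop := Finset.univ.gcd r = 1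

/-- `r` is a primitive vector of `ℤⁿ` parallel to the edge `E`. -/
def IsPrimitiveDirection {n : ℕ} (E : Set (Fin n → ℝ)) (r : Fin n → ℤ) : Prop :=
  IsPrimitiveVec r ∧ intPt r ∈ vectorSpan ℝ E

/-- The determinant of an edge star whose edges are parallel to the primitive vectors
`r₁, …, rₘ`: the sum of `|det (r_{i₁}, …, r_{iₙ})|` over all `i₁ < ⋯ < iₙ`. -/
noncomputable def edgeStarDet {n m : ℕ} (r : Fin m → Fin n → ℤ) : ℕ :=
  ∑ i : Fin n ↪o Fin m, (Matrix.of fun j => r (i j)).det.natAbs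

/-- The smallest sublattice (subgroup) of `ℤⁿ` containing `ℤⁿ ∩ aff F - a`. -/
def distLattice {n : ℕ} (F : Set (Fin n → ℝ)) (a : Fin n → ℤ) : AddSubgroup (Fin n → ℤ) :=
  AddSubgroup.closure {w | intPt (w + a) ∈ affineSpan ℝ F}

/-- The integer distance from `F` to `a`: the index in `ℤⁿ` of the smallest sublattice
containing `ℤⁿ ∩ aff F - a` (it is `⊤` when the index is infinite). -/
noncomputable def integerDistance {n : ℕ} (F : Set (Fin n → ℝ)) (a : Fin n → ℤ) : ℕ∞ :=
  ENat.card ((Fin n → ℤ) ⧸ distLattice F a)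

/-!
The edge directions at `v` generate the cone of `P` at `v`, and since every vertex is integral and
the `rᵢ` are primitive, `v ± rᵢ ∈ P` for the right sign. As `v` lies in the interior of
`conv (P ∪ {0})`, it lies in this cone, so `v = ∑ dᵢ qᵢ` with `dᵢ ≥ 0` and linearly independent
`qᵢ = ± rᵢ`. If `∑ dᵢ` were at least `n ^ (4 * n!)`, simultaneous Diophantine approximation of the
weights `dᵢ / (1 + ∑ dⱼ)` would yield natural numbers `kᵢ`, not all zero, with `v - ∑ kᵢ qᵢ` a
nonzero lattice point of `conv (P ∪ {0})` outside `P`.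

The integer distance of a facet through `v` is at most `|det (v, b₁, …, bₙ₋₁)|` for linearly
independent edge vectors `bⱼ` spanning its direction. Expanding `v = ∑ dᵢ qᵢ` in the first row
bounds this by `(∑ dᵢ) * edgeStarDet r`.
-/

open Finset Topology

section SimultaneousApproximation

variable {ι : Type*}

theorem exists_nat_le_pow_card_abs_mul_sub_le (s : Finset ι) (ξ : ι → ℝ) {T : ℕ} (hT : 0 < T) :
    ∃ N : ℕ, 1 ≤ N ∧ N ≤ T ^ #s ∧ ∃ k : ι → ℤ, ∀ i ∈ s, |N * ξ i - k i| ≤ 1 / T := by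
  classical
  have hT' : (0 : ℝ) < T := by exact_mod_cast hT
  let box : ℕ → ∀ i ∈ s, ℤ := fun N i _ => ⌊T * Int.fract (N * ξ i)⌋
  have maps : Set.MapsTo box (range (T ^ #s + 1)) (s.pi fun _ => Ico (0 : ℤ) T) := by
    intro N _
    simp only [mem_coe, mem_pi, mem_Ico, box, Int.floor_nonneg,
      Int.floor_lt, Int.cast_natCast]
    exact fun i _ => ⟨by positivity, mul_lt_of_lt_one_right hT' (Int.fract_lt_one _)⟩
  obtain ⟨a, ha, b, hb, hab, hbox⟩ :=
    exists_ne_map_eq_of_card_lt_of_maps_to (by simp [card_pi]) maps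
  wlog hlt : a < b generalizing a b
  · exact this b hb a ha hab.symm hbox.symm (by omega)
  refine ⟨b - a, by omega, by grind, fun i => ⌊b * ξ i⌋ - ⌊a * ξ i⌋, fun i hi => ?_⟩
  have hfloor : ⌊T * Int.fract (b * ξ i)⌋ = ⌊T * Int.fract (a * ξ i)⌋ :=
    (congrFun₂ hbox i hi).symm
  calc |((b - a : ℕ) : ℝ) * ξ i - ((⌊b * ξ i⌋ - ⌊a * ξ i⌋ : ℤ) : ℝ)|
      = |Int.fract (b * ξ i) - Int.fract (a * ξ i)| := by
        rw [Nat.cast_sub hlt.le, Int.fract, Int.fract]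
        push_cast
        ring_nf
    _ ≤ 1 / T := by
        rw [le_div_iff₀ hT', ← Nat.abs_cast T, ← abs_mul, sub_mul,
          mul_comm _ (T : ℝ), mul_comm _ (T : ℝ)]
        exact (Int.abs_sub_lt_one_of_floor_eq_floor hfloor).le

theorem exists_int_sum_eq_abs_mul_sub_le {s : Finset ι} (hs : s.Nonempty) {μ : ι → ℝ} {T : ℕ}
    (hT : 0 < T) (hμT : ∀ i ∈ s, 1 / T ≤ μ i) (hμ : ∑ i ∈ s, μ i ≤ 1)
    (hgap : T ^ (#s - 1) * (1 - ∑ i ∈ s, μ i) + (#s - 1) / T ≤ (∑ i ∈ s, μ i) / #s) :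
    ∃ N : ℕ, 1 ≤ N ∧ N ≤ T ^ (#s - 1) ∧
      ∃ k : ι → ℤ, ∑ i ∈ s, k i = N ∧ ∀ i ∈ s, |N * μ i - k i| ≤ μ i := by
  classical
  obtain ⟨i₀, hi₀, hmax⟩ := s.exists_max_image μ hs
  have hμi₀ : (∑ i ∈ s, μ i) / #s ≤ μ i₀ := by
    rw [div_le_iff₀ (by exact_mod_cast hs.card_pos), mul_comm, ← nsmul_eq_mul]
    exact sum_le_card_nsmul s μ _ hmax
  obtain ⟨N, hN1, hN, g, hg⟩ := exists_nat_le_pow_card_abs_mul_sub_le (s.erase i₀) μ hT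
  rw [card_erase_of_mem hi₀] at hN
  let k : ι → ℤ := Function.update g i₀ (N - ∑ i ∈ s.erase i₀, g i)
  have hk : ∀ i ∈ s.erase i₀, k i = g i :=
    fun i hi => Function.update_of_ne (ne_of_mem_erase hi) _ _
  have hk₀ : k i₀ = N - ∑ i ∈ s.erase i₀, g i := Function.update_self _ _ _
  refine ⟨N, hN1, hN, k, ?_, fun i hi => ?_⟩
  · rw [← add_sum_erase s k hi₀, hk₀, sum_congr rfl hk, sub_add_cancel]
  by_cases h : i ≠ i₀
  · have hi' : i ∈ s.erase i₀ := mem_erase.2 ⟨h, hi⟩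
    rw [hk i hi']
    exact (hg i hi').trans (hμT i hi)
  obtain rfl := not_ne_iff.1 h
  have herr : N * μ i - k i =
      -(N * (1 - ∑ j ∈ s, μ j) + ∑ j ∈ s.erase i, (N * μ j - g j)) := by
    rw [hk₀, sum_sub_distrib, ← mul_sum, ← add_sum_erase s μ hi]
    push_cast
    ring
  have hsum : |∑ j ∈ s.erase i, (N * μ j - g j)| ≤ (#s - 1) / T := by
    refine (abs_sum_le_sum_abs _ _).trans ((sum_le_sum hg).trans_eq ?_)
    rw [sum_const, card_erase_of_mem hi, nsmul_eq_mul, Nat.cast_pred hs.card_pos, mul_one_div]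
  have hNle : (N : ℝ) ≤ T ^ (#s - 1) := by exact_mod_cast hN
  calc |N * μ i - k i| ≤ |N * (1 - ∑ j ∈ s, μ j)| + |∑ j ∈ s.erase i, (N * μ j - g j)| := by
        rw [herr, abs_neg]
        exact abs_add_le _ _
    _ ≤ T ^ (#s - 1) * (1 - ∑ j ∈ s, μ j) + (#s - 1) / T := by
        rw [abs_of_nonneg (mul_nonneg N.cast_nonneg (sub_nonneg.2 hμ))]
        gcongr
    _ ≤ μ i := hgap.trans hμi₀

open scoped Nat in
theorem four_mul_succ_mul_pow_le_pow_factorial {n i : ℕ} (hi : 1 ≤ i) (hin : i + 1 ≤ n) :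
    4 * (i + 1) * (2 * n ^ (4 * i !)) ^ i ≤ n ^ (4 * (i + 1)!) := by
  have hn : 2 ≤ n := by omega
  have hexp : 3 + i + 4 * i ! * i ≤ 4 * (i + 1)! := by
    rw [Nat.factorial_succ]
    nlinarith [i.self_le_factorial]
  calc 4 * (i + 1) * (2 * n ^ (4 * i !)) ^ i
      ≤ (n * n) * n * (n * n ^ (4 * i !)) ^ i := by
        gcongr
        exact Nat.mul_le_mul hn hn
    _ = n ^ (3 + i + 4 * i ! * i) := by ring
    _ ≤ n ^ (4 * (i + 1)!) := Nat.pow_le_pow_right (by omega) hexp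

/-- There is a nonzero natural vector `k`, of sum `N` over `s`, approximating the weights `μ` so
well that the weights `(N + 1) μ - k` are nonnegative and have the positive sum
`1 - (N + 1) (1 - ∑ μ)`. They are the coefficients left when `∑ kᵢ qᵢ` is subtracted from a large
conical combination of vectors `qᵢ` with coefficients proportional to `μ`. -/
def HasNatApprox (s : Finset ι) (μ : ι → ℝ) : Prop :=
  ∃ k : ι → ℕ, 1 ≤ ∑ a ∈ s, k a ∧ (∀ a ∈ s, (k a : ℝ) ≤ (∑ a ∈ s, k a + 1) * μ a) ∧
    (∑ a ∈ s, k a + 1) * (1 - ∑ a ∈ s, μ a) < 1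

theorem HasNatApprox.mono {s t : Finset ι} {μ : ι → ℝ} (h : HasNatApprox t μ) (hts : t ⊆ s)
    (hμ : ∀ a ∈ s, 0 ≤ μ a) : HasNatApprox s μ := by
  classical
  obtain ⟨k, hk1, hk, hkμ⟩ := h
  have hsum : ∑ a ∈ s, (if a ∈ t then k a else 0) = ∑ a ∈ t, k a := by
    rw [sum_ite_mem, inter_eq_right.2 hts]
  have hμle : ∑ a ∈ t, μ a ≤ ∑ a ∈ s, μ a :=
    sum_le_sum_of_subset_of_nonneg hts fun a ha _ => hμ a ha
  refine ⟨fun a => if a ∈ t then k a else 0, by rwa [hsum], fun a ha => ?_, ?_⟩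
  · simp only [hsum]
    split_ifs with hat
    · exact hk a hat
    · exact Nat.cast_zero.trans_le (mul_nonneg (by positivity) (hμ a ha))
  · rw [hsum]
    exact lt_of_le_of_lt (mul_le_mul_of_nonneg_left (by linarith) (by positivity)) hkμ

theorem exists_nat_sum_le_pow_le_mul {s : Finset ι} (hs : s.Nonempty) {μ : ι → ℝ} {T : ℕ}
    (hT : 0 < T) (hμT : ∀ i ∈ s, 1 / T ≤ μ i) (hμ : ∑ i ∈ s, μ i ≤ 1)
    (hgap : T ^ (#s - 1) * (1 - ∑ i ∈ s, μ i) + (#s - 1) / T ≤ (∑ i ∈ s, μ i) / #s) :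
    ∃ k : ι → ℕ, 1 ≤ ∑ i ∈ s, k i ∧ ∑ i ∈ s, k i ≤ T ^ (#s - 1) ∧
      ∀ i ∈ s, (k i : ℝ) ≤ (∑ i ∈ s, k i + 1) * μ i := by
  obtain ⟨N, hN1, hN, k, hsum, hk⟩ := exists_int_sum_eq_abs_mul_sub_le hs hT hμT hμ hgap
  have hk0 : ∀ i ∈ s, 0 ≤ k i := fun i hi => by
    have hμi : 0 ≤ μ i := le_trans (by positivity) (hμT i hi)
    have hN1' : (1 : ℝ) ≤ N := mod_cast hN1
    have : (0 : ℝ) ≤ k i := by nlinarith [(abs_le.1 (hk i hi)).2]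
    exact_mod_cast this
  have hcast : ∀ i ∈ s, (((k i).toNat : ℤ)) = k i := fun i hi => Int.toNat_of_nonneg (hk0 i hi)
  have hsum' : ∑ i ∈ s, (k i).toNat = N := by
    have : ((∑ i ∈ s, (k i).toNat : ℕ) : ℤ) = N := by
      rw [Nat.cast_sum, sum_congr rfl hcast, hsum]
    exact_mod_cast this
  refine ⟨fun i => (k i).toNat, by rwa [hsum'], by rwa [hsum'], fun i hi => ?_⟩
  have hki : (((k i).toNat : ℕ) : ℝ) = k i := mod_cast congrArg (Int.cast (R := ℝ)) (hcast i hi)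
  simp only [hsum', hki]
  linarith [(abs_le.1 (hk i hi)).1]

theorem pow_mul_le_one_div_four_mul {i D D' : ℕ} (hD : 0 < D)
    (hD' : 4 * (i + 1) * (2 * D) ^ i ≤ D') {ε : ℝ} (hε0 : 0 ≤ ε) (hε : ε < 1 / D') :
    (2 * D : ℕ) ^ i * ε ≤ 1 / (4 * (i + 1)) := by
  have hle : 4 * (i + 1) * ((2 * D : ℕ) ^ i : ℝ) ≤ D' := mod_cast hD'
  have hlt : ε * D' < 1 := (lt_div_iff₀ (lt_of_lt_of_le (by positivity) hle)).1 hε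
  rw [le_div_iff₀ (by positivity)]
  nlinarith

theorem pow_mul_add_div_le_one_sub_div {i D : ℕ} (hD : (i + 1) * (i + 1) ≤ D) {ε : ℝ}
    (hε0 : 0 ≤ ε) (hε : (2 * D : ℕ) ^ i * ε ≤ 1 / (4 * (i + 1))) :
    (2 * D : ℕ) ^ i * ε + i / (2 * D : ℕ) ≤ (1 - ε) / (i + 1) := by
  have hD0 : 0 < D := by nlinarith
  have hpow : (1 : ℝ) ≤ (2 * D : ℕ) ^ i := mod_cast Nat.one_le_pow _ _ (by omega)
  have hε4 : ε ≤ 1 / 4 :=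
    calc ε ≤ (2 * D : ℕ) ^ i * ε := le_mul_of_one_le_left hε0 hpow
      _ ≤ 1 / (4 * (i + 1)) := hε
      _ ≤ 1 / 4 := by gcongr; linarith
  have herr : (i : ℝ) / (2 * D : ℕ) ≤ 1 / (2 * (i + 1)) := by
    have hD' : ((i + 1) * (i + 1) : ℝ) ≤ D := mod_cast hD
    rw [div_le_div_iff₀ (by positivity) (by positivity)]
    push_cast
    nlinarith
  calc ((2 * D : ℕ) : ℝ) ^ i * ε + i / (2 * D : ℕ)
      ≤ 1 / (4 * (i + 1)) + 1 / (2 * (i + 1)) := add_le_add hε herr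
    _ = (1 - 1 / 4) / (i + 1) := by field_simp; norm_num
    _ ≤ (1 - ε) / (i + 1) := by gcongr

theorem hasNatApprox_of_forall_le {i D D' : ℕ} (hD : (i + 1) * (i + 1) ≤ D)
    (hD' : 4 * (i + 1) * (2 * D) ^ i ≤ D') {s : Finset ι} (hs : #s = i + 1) {μ : ι → ℝ}
    (hμ : ∑ a ∈ s, μ a ≤ 1) (hμD : ∀ a ∈ s, 1 / (2 * D) ≤ μ a)
    (hnear : 1 - ∑ a ∈ s, μ a < 1 / D') :
    HasNatApprox s μ := by
  set ε := 1 - ∑ a ∈ s, μ a with hε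
  have hε0 : 0 ≤ ε := sub_nonneg.2 hμ
  have hD0 : 0 < D := by nlinarith
  have hpow : (1 : ℝ) ≤ (2 * D : ℕ) ^ i := mod_cast Nat.one_le_pow _ _ (by omega)
  have hpowε := pow_mul_le_one_div_four_mul hD0 hD' hε0 hnear
  have hgap : ((2 * D : ℕ) : ℝ) ^ (#s - 1) * ε + (#s - 1) / (2 * D : ℕ) ≤
      (∑ a ∈ s, μ a) / #s := by
    rw [hs, Nat.add_sub_cancel, show ∑ a ∈ s, μ a = 1 - ε by simp [hε], Nat.cast_succ,
      add_sub_cancel_right]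
    exact pow_mul_add_div_le_one_sub_div hD hε0 hpowε
  obtain ⟨k, hk1, hkpow, hk⟩ := exists_nat_sum_le_pow_le_mul (card_pos.1 (by omega)) (by omega)
    (mod_cast hμD) hμ hgap
  refine ⟨k, hk1, hk, ?_⟩
  rw [hs, Nat.add_sub_cancel] at hkpow
  calc ((∑ a ∈ s, k a : ℕ) + 1) * ε ≤ ((2 * D : ℕ) ^ i + (2 * D : ℕ) ^ i) * ε := by
        gcongr
        exact_mod_cast hkpow
    _ ≤ 2 * (1 / (4 * (i + 1))) := by linarith
    _ < 1 := by
        rw [mul_one_div, div_lt_one (by positivity)]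
        linarith [(i.cast_nonneg : (0 : ℝ) ≤ i)]

theorem hasNatApprox_singleton {a : ι} {μ : ι → ℝ} (hμ : 1 - μ a < 1 / 2) :
    HasNatApprox {a} μ :=
  ⟨fun _ => 1, by simp, by simp; linarith, by simp; linarith⟩

open scoped Nat in
theorem hasNatApprox_of_sum_near_one {n : ℕ} (hn : 2 ≤ n) {s : Finset ι} (hs : s.Nonempty)
    (hsn : #s ≤ n) {μ : ι → ℝ} (hμ0 : ∀ a ∈ s, 0 ≤ μ a) (hμ : ∑ a ∈ s, μ a ≤ 1)
    (hnear : 1 - ∑ a ∈ s, μ a < 1 / n ^ (4 * (#s)!)) :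
    HasNatApprox s μ := by
  classical
  have hn' : (2 : ℝ) ≤ n := mod_cast hn
  induction hcard : #s generalizing s with
  | zero => simp [hs.ne_empty] at hcard
  | succ i ih =>
  rw [hcard] at hnear hsn
  rcases Nat.eq_zero_or_pos i with rfl | hi
  · obtain ⟨a, rfl⟩ := card_eq_one.1 hcard
    rw [sum_singleton] at hnear
    refine hasNatApprox_singleton (hnear.trans_le (one_div_le_one_div_of_le two_pos ?_))
    exact hn'.trans (le_self_pow₀ (by linarith) (by simp))
  have hD : 4 * (i + 1) * (2 * n ^ (4 * i !)) ^ i ≤ n ^ (4 * (i + 1)!) :=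
    four_mul_succ_mul_pow_le_pow_factorial hi hsn
  by_cases hall : ∀ a ∈ s, 1 / (2 * (n ^ (4 * i !) : ℕ)) ≤ μ a
  · refine hasNatApprox_of_forall_le ?_ hD hcard hμ hall (mod_cast hnear)
    calc (i + 1) * (i + 1) ≤ n ^ 2 := by nlinarith
      _ ≤ n ^ (4 * i !) := Nat.pow_le_pow_right (by omega) (by have := i.factorial_pos; omega)
  -- A weight too small for Dirichlet's theorem is dropped at the cost of a larger defect.
  push Not at hall
  obtain ⟨a, ha, hμa⟩ := hall
  have hsum : ∑ b ∈ s, μ b = μ a + ∑ b ∈ s.erase a, μ b := (add_sum_erase s μ ha).symm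
  have hcard' : #(s.erase a) = i := by rw [card_erase_of_mem ha, hcard, Nat.add_sub_cancel]
  have hDD : (2 : ℝ) * n ^ (4 * i !) ≤ n ^ (4 * (i + 1)!) := mod_cast
    (Nat.le_self_pow hi.ne' _).trans ((Nat.le_mul_of_pos_left _ (by omega)).trans hD)
  have hnear' : 1 - ∑ b ∈ s.erase a, μ b < 1 / n ^ (4 * i !) :=
    calc 1 - ∑ b ∈ s.erase a, μ b = 1 - ∑ b ∈ s, μ b + μ a := by linarith
      _ < 1 / (2 * n ^ (4 * i !)) + 1 / (2 * n ^ (4 * i !)) :=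
        add_lt_add (hnear.trans_le (one_div_le_one_div_of_le (by positivity) hDD)) (mod_cast hμa)
      _ = 1 / n ^ (4 * i !) := by field_simp; norm_num
  have hμa0 : 0 ≤ μ a := hμ0 a ha
  exact (ih (card_pos.1 (by omega)) (by omega) (fun b hb => hμ0 b (mem_of_mem_erase hb))
    (by linarith) (by rwa [hcard']) hcard').mono (erase_subset a s) hμ0

end SimultaneousApproximation

section Cone

variable {V : Type*} [AddCommGroup V] [Module ℝ V]

theorem mem_hull_finset {t : Finset V} {x : V} :
    x ∈ PointedCone.hull ℝ (t : Set V) ↔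
      ∃ d : V → ℝ, (∀ a ∈ t, 0 ≤ d a) ∧ ∑ a ∈ t, d a • a = x := by
  classical
  constructor
  · intro h
    obtain ⟨d, -, hd⟩ := Submodule.mem_span_finset.1 h
    exact ⟨fun a => d a, fun a _ => (d a).2, hd⟩
  · rintro ⟨d, hd, rfl⟩
    exact sum_mem fun a ha => PointedCone.smul_mem _ (hd a ha) (PointedCone.subset_hull ha)

theorem exists_mem_hull_erase [DecidableEq V] {t : Finset V} {x : V}
    (ht : ¬ LinearIndepOn ℝ id (t : Set V)) (hx : x ∈ PointedCone.hull ℝ (t : Set V)) :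
    ∃ a ∈ t, x ∈ PointedCone.hull ℝ (t.erase a : Set V) := by
  obtain ⟨c, hc, rfl⟩ := mem_hull_finset.1 hx
  obtain ⟨g, hg, a₁, ha₁, hga₁⟩ : ∃ g : V → ℝ, ∑ a ∈ t, g a • a = 0 ∧ ∃ a ∈ t, 0 < g a := by
    obtain ⟨g, hg, a, ha, hga⟩ : ∃ g : V → ℝ, ∑ a ∈ t, g a • a = 0 ∧ ∃ a ∈ t, g a ≠ 0 := by
      simpa [linearIndepOn_finset_iff] using ht
    rcases hga.lt_or_gt with h | h
    · exact ⟨-g, by simpa using hg, a, ha, by simpa using h⟩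
    · exact ⟨g, hg, a, ha, h⟩
  obtain ⟨b, hb, hmin⟩ := {a ∈ t | 0 < g a}.exists_min_image (fun a => c a / g a)
    ⟨a₁, mem_filter.2 ⟨ha₁, hga₁⟩⟩
  simp only [mem_filter, and_imp] at hb hmin
  have hratio : 0 ≤ c b / g b := div_nonneg (hc b hb.1) hb.2.le
  refine ⟨b, hb.1, mem_hull_finset.2 ⟨fun a => c a - c b / g b * g a, fun a ha => ?_, ?_⟩⟩
  · have ha' := mem_of_mem_erase ha
    rcases le_or_gt (g a) 0 with h | h
    · linarith [hc a ha', mul_nonpos_of_nonneg_of_nonpos hratio h]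
    · linarith [(le_div_iff₀ h).1 (hmin a ha' h)]
  · rw [sum_erase t (by simp [hb.2.ne'])]
    simp only [sub_smul, mul_smul, sum_sub_distrib, ← smul_sum, hg, smul_zero, sub_zero]

theorem exists_linearIndepOn_mem_hull {T : Set V} {x : V} (hx : x ∈ PointedCone.hull ℝ T) :
    ∃ t : Finset V, ↑t ⊆ T ∧ LinearIndepOn ℝ id (t : Set V) ∧
      x ∈ PointedCone.hull ℝ (t : Set V) := by
  classical
  obtain ⟨t, htT, ht⟩ := Submodule.mem_span_finite_of_mem_span hx
  induction t using Finset.strongInduction with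
  | H t ih =>
  by_cases hli : LinearIndepOn ℝ id (t : Set V)
  · exact ⟨t, htT, hli, ht⟩
  · obtain ⟨a, ha, hxa⟩ := exists_mem_hull_erase hli ht
    exact ih _ (erase_ssubset ha) (subset_trans (mod_cast erase_subset a t) htT) hxa

theorem apply_nonpos_of_mem_hull {T : Set V} {l : V →ₗ[ℝ] ℝ} (hl : ∀ t ∈ T, l t ≤ 0) {x : V}
    (hx : x ∈ PointedCone.hull ℝ T) : l x ≤ 0 := by
  have hle : PointedCone.hull ℝ T ≤ (PointedCone.positive ℝ ℝ).comap (-l) :=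
    Submodule.span_le.2 fun t ht => by simpa using hl t ht
  simpa using hle hx

theorem mem_hull_sep_of_apply_eq_zero {T : Set V} {l : V →ₗ[ℝ] ℝ} (hl : ∀ t ∈ T, l t ≤ 0) {x : V}
    (hx : x ∈ PointedCone.hull ℝ T) (hlx : l x = 0) :
    x ∈ PointedCone.hull ℝ {t ∈ T | l t = 0} := by
  induction hx using Submodule.span_induction with
  | mem t ht => exact PointedCone.subset_hull ⟨ht, hlx⟩
  | zero => exact zero_mem _
  | add x y hx hy ihx ihy =>
    rw [map_add] at hlx
    have hlx0 := apply_nonpos_of_mem_hull hl hx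
    have hly0 := apply_nonpos_of_mem_hull hl hy
    exact add_mem (ihx (by linarith)) (ihy (by linarith))
  | smul c x _ ih =>
    change l ((c : ℝ) • x) = 0 at hlx
    rw [map_smul, smul_eq_mul, mul_eq_zero] at hlx
    rcases hlx with hc | hlx
    · rw [show c = 0 from Subtype.ext hc, zero_smul]
      exact zero_mem _
    · exact Submodule.smul_mem _ c (ih hlx)

end Cone

section Exposed

theorem exists_lt_of_mem_extremePoints_convexHull {V : Type*} [NormedAddCommGroup V]
    [NormedSpace ℝ V] {S : Finset V} {w : V} (hw : w ∈ (convexHull ℝ (S : Set V)).extremePoints ℝ) :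
    ∃ l : StrongDual ℝ V, ∀ x ∈ S, x ≠ w → l x < l w := by
  classical
  have hnot : w ∉ convexHull ℝ (S.erase w : Set V) := fun h =>
    ((convex_convexHull ℝ _).mem_extremePoints_iff_mem_sdiff_convexHull_sdiff.1 hw).2 <|
      convexHull_mono (by
        rw [coe_erase]
        exact Set.sdiff_subset_sdiff_left (subset_convexHull ℝ _)) h
  obtain ⟨l, u, hlt, hu⟩ := geometric_hahn_banach_closed_point (convex_convexHull ℝ _)
    ((S.erase w).finite_toSet.isCompact_convexHull ℝ).isClosed hnot
  exact ⟨l, fun x hx hxw =>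
    (hlt x (subset_convexHull ℝ _ (mem_coe.2 (mem_erase.2 ⟨hxw, hx⟩)))).trans hu⟩

theorem hull_le_of_forall_exposed {V : Type*} [NormedAddCommGroup V] [NormedSpace ℝ V]
    {T : Finset V} {l : StrongDual ℝ V} (hl : ∀ t ∈ T, l t = 1) {C : PointedCone ℝ V}
    (hC : ∀ e ∈ T, ∀ h : StrongDual ℝ V, h e = 0 → (∀ t ∈ T, t ≠ e → h t < 0) → e ∈ C) :
    PointedCone.hull ℝ (T : Set V) ≤ C := by
  have hext : (convexHull ℝ (T : Set V)).extremePoints ℝ ⊆ C := fun e he => by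
    have heT : e ∈ T := extremePoints_convexHull_subset he
    obtain ⟨g, hg⟩ := exists_lt_of_mem_extremePoints_convexHull he
    exact hC e heT (g - g e • l) (by simp [hl e heT]) fun t ht hte => by
      simpa [hl t ht] using hg t ht hte
  have hcompact : IsCompact (convexHull ℝ (T : Set V)) := T.finite_toSet.isCompact_convexHull ℝ
  have hfin : ((convexHull ℝ (T : Set V)).extremePoints ℝ).Finite :=
    T.finite_toSet.subset extremePoints_convexHull_subset
  -- All of `T` lies on `l = 1`, so it suffices to treat the extreme points of its hull.
  refine Submodule.span_le.2 fun t ht => convexHull_min hext (PointedCone.convex C) ?_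
  rw [← (hfin.isCompact_convexHull ℝ).isClosed.closure_eq,
    closure_convexHull_extremePoints hcompact (convex_convexHull ℝ _)]
  exact subset_convexHull ℝ _ ht

variable {V : Type*} [AddCommGroup V] [TopologicalSpace V] [Module ℝ V] {P T : Set V} {v : V}
  {l : StrongDual ℝ V}

theorem mem_toExposed_iff_sub_mem_hull (hv : v ∈ P) (hPT : ∀ x ∈ P, x - v ∈ PointedCone.hull ℝ T)
    (hl : ∀ t ∈ T, l t ≤ 0) {x : V} :
    x ∈ l.toExposed P ↔ x ∈ P ∧ x - v ∈ PointedCone.hull ℝ {t ∈ T | l t = 0} := by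
  have hle : ∀ y ∈ P, l y ≤ l v := fun y hy => by
    simpa using apply_nonpos_of_mem_hull (l := (l : V →ₗ[ℝ] ℝ)) hl (hPT y hy)
  constructor
  · rintro ⟨hx, hmax⟩
    refine ⟨hx, mem_hull_sep_of_apply_eq_zero (l := (l : V →ₗ[ℝ] ℝ)) hl (hPT x hx) ?_⟩
    simpa [sub_eq_zero] using (hle x hx).antisymm (hmax v hv)
  · rintro ⟨hx, hxv⟩
    have hnonpos := apply_nonpos_of_mem_hull (l := (l : V →ₗ[ℝ] ℝ)) (fun t ht => ht.2.le) hxv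
    have hnonneg := apply_nonpos_of_mem_hull (l := -(l : V →ₗ[ℝ] ℝ))
      (fun t ht => by simpa using ht.2.ge) hxv
    have hzero : l (x - v) = 0 := hnonpos.antisymm (by simpa using hnonneg)
    rw [map_sub, sub_eq_zero] at hzero
    exact ⟨hx, fun y hy => (hle y hy).trans_eq hzero.symm⟩

theorem vectorSpan_toExposed (hv : v ∈ P) (hPT : ∀ x ∈ P, x - v ∈ PointedCone.hull ℝ T)
    (hTP : ∀ t ∈ T, ∃ c : ℝ, 0 < c ∧ v + c • t ∈ P) (hl : ∀ t ∈ T, l t ≤ 0) :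
    vectorSpan ℝ (l.toExposed P) = Submodule.span ℝ {t ∈ T | l t = 0} := by
  have hvF : v ∈ l.toExposed P := (mem_toExposed_iff_sub_mem_hull hv hPT hl).2 ⟨hv, by simp⟩
  rw [vectorSpan_eq_span_vsub_set_right ℝ hvF]
  refine le_antisymm (Submodule.span_le.2 ?_) (Submodule.span_le.2 fun t ht => ?_)
  · rintro _ ⟨x, hx, rfl⟩
    exact PointedCone.hull_le_span ℝ _ ((mem_toExposed_iff_sub_mem_hull hv hPT hl).1 hx).2
  · obtain ⟨c, hc, hct⟩ := hTP t ht.1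
    have hF : v + c • t ∈ l.toExposed P := (mem_toExposed_iff_sub_mem_hull hv hPT hl).2
      ⟨hct, by simpa using PointedCone.smul_mem _ hc.le (PointedCone.subset_hull ht)⟩
    have : c⁻¹ • ((v + c • t) - v) = t := by simp [smul_smul, hc.ne']
    rw [← this]
    exact Submodule.smul_mem _ _ (Submodule.subset_span ⟨_, hF, rfl⟩)

theorem apply_eq_zero_of_mem_vectorSpan_toExposed {w : V}
    (hw : w ∈ vectorSpan ℝ (l.toExposed P)) : l w = 0 := by
  have hle : vectorSpan ℝ (l.toExposed P) ≤ LinearMap.ker (l : V →ₗ[ℝ] ℝ) := by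
    refine Submodule.span_le.2 ?_
    rintro _ ⟨x, hx, y, hy, rfl⟩
    simpa [sub_eq_zero] using (hy.2 x hx.1).antisymm (hx.2 y hy.1)
  exact hle hw

theorem mem_toExposed_of_sub_mem_vectorSpan {x : V} (hv : v ∈ l.toExposed P) (hx : x ∈ P)
    (hxv : x - v ∈ vectorSpan ℝ (l.toExposed P)) : x ∈ l.toExposed P := by
  have hlx := apply_eq_zero_of_mem_vectorSpan_toExposed hxv
  rw [map_sub, sub_eq_zero] at hlx
  exact ⟨hx, fun y hy => hlx ▸ hv.2 y hy⟩

end Exposed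

section Polyhedron

theorem exists_add_smul_mem {V : Type*} [AddCommGroup V] [Module ℝ V] [TopologicalSpace V]
    [ContinuousAdd V] [ContinuousSMul ℝ V] {s : Set V} {v : V} (hs : s ∈ 𝓝 v) (d : V) :
    ∃ t ∈ Set.Ioc (0 : ℝ) 1, v + t • d ∈ s := by
  have hcont : Continuous fun t : ℝ => v + t • d := by fun_prop
  have hnear : ∀ᶠ t in 𝓝[>] (0 : ℝ), v + t • d ∈ s :=
    (hcont.tendsto' 0 v (by simp)).mono_left nhdsWithin_le_nhds hs
  obtain ⟨t, hts, ht⟩ := (hnear.and (Ioc_mem_nhdsGT one_pos)).exists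
  exact ⟨t, ht, hts⟩

variable {n : ℕ} {P : Set (Fin n → ℝ)} {v : Fin n → ℝ}

theorem IsConvexPolyhedron.exists_finset_sub_mem_hull (hP : IsConvexPolyhedron P) (hv : v ∈ P) :
    ∃ S : Finset (Fin n → ℝ), convexHull ℝ (S : Set (Fin n → ℝ)) ⊆ P ∧
      v ∈ convexHull ℝ (S : Set (Fin n → ℝ)) ∧
      ∀ x ∈ P, x - v ∈ PointedCone.hull ℝ ((fun s => s - v) '' (S : Set (Fin n → ℝ))) := by
  classical
  obtain ⟨b, hb, -⟩ := exists_mem_interior_convexHull_affineBasis (x := v) Filter.univ_mem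
  obtain ⟨S, hS⟩ := hP.2 (univ.image b)
  rw [coe_image, coe_univ, Set.image_univ] at hS
  have hconv : convexHull ℝ (S : Set (Fin n → ℝ)) ⊆
      (fun y => y - v) ⁻¹' (PointedCone.hull ℝ ((fun s => s - v) '' (S : Set (Fin n → ℝ)))) := by
    refine convexHull_min (fun s hs => PointedCone.subset_hull ⟨s, hs, rfl⟩) ?_
    simpa only [sub_eq_add_neg] using (PointedCone.convex _).translate_preimage_left (-v)
  refine ⟨S, hS ▸ Set.inter_subset_left, hS ▸ ⟨hv, interior_subset hb⟩, fun x hx => ?_⟩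
  obtain ⟨t, ht, htb⟩ := exists_add_smul_mem (mem_interior_iff_mem_nhds.1 hb) (x - v)
  have htS : v + t • (x - v) ∈ convexHull ℝ (S : Set (Fin n → ℝ)) :=
    hS ▸ ⟨hP.1.add_smul_sub_mem hv hx ⟨ht.1.le, ht.2⟩, htb⟩
  have htC := PointedCone.smul_mem _ (inv_nonneg.2 ht.1.le) (hconv htS)
  beta_reduce at htC
  rwa [add_sub_cancel_left, smul_smul, inv_mul_cancel₀ ht.1.ne', one_smul] at htC

theorem isVertexOf_of_toExposed_eq_singleton {l : StrongDual ℝ (Fin n → ℝ)}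
    (hl : l.toExposed P = {v}) : IsVertexOf P v :=
  ⟨Set.singleton_nonempty v, hl ▸ ContinuousLinearMap.toExposed.isExposed, by simp [affDim]⟩

theorem IsConvexPolyhedron.isVertexOf_of_mem_extremePoints (hP : IsConvexPolyhedron P)
    (hv : v ∈ P.extremePoints ℝ) : IsVertexOf P v := by
  obtain ⟨S, hSP, hvS, hPS⟩ := hP.exists_finset_sub_mem_hull hv.1
  obtain ⟨l, hl⟩ := exists_lt_of_mem_extremePoints_convexHull
    (inter_extremePoints_subset_extremePoints_of_subset hSP ⟨hvS, hv⟩)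
  have hlS : ∀ t ∈ (fun s => s - v) '' (S : Set (Fin n → ℝ)), l t ≤ 0 ∧ (l t = 0 → t = 0) := by
    rintro _ ⟨s, hs, rfl⟩
    rcases eq_or_ne s v with rfl | hsv
    · simp
    · have := hl s hs hsv
      simp only [map_sub]
      exact ⟨by linarith, fun h => by linarith⟩
  refine isVertexOf_of_toExposed_eq_singleton (l := l) (Set.ext fun x => ?_)
  rw [mem_toExposed_iff_sub_mem_hull hv.1 hPS fun t ht => (hlS t ht).1, Set.mem_singleton_iff]
  refine ⟨fun ⟨_, hx⟩ => ?_, fun h => by simp [h, hv.1]⟩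
  have hbot : PointedCone.hull ℝ {t ∈ (fun s => s - v) '' (S : Set (Fin n → ℝ)) | l t = 0} ≤ ⊥ :=
    Submodule.span_le.2 fun t ht => (hlS t ht.1).2 ht.2
  exact sub_eq_zero.1 (hbot hx)

theorem IsVertexOf.mem (hv : IsVertexOf P v) : v ∈ P :=
  hv.2.1.subset rfl

theorem IsVertexOf.exists_pos (hv : IsVertexOf P v) :
    ∃ l : StrongDual ℝ (Fin n → ℝ), ∀ x ∈ P, x ≠ v → 0 < l (x - v) := by
  obtain ⟨l, hl⟩ := hv.2.1 ⟨v, rfl⟩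
  have hvmax : v ∈ l.toExposed P := hl.subset rfl
  refine ⟨-l, fun x hx hxv => ?_⟩
  have hlt : l x < l v := lt_of_le_of_ne (hvmax.2 x hx) fun h =>
    hxv (hl.symm.subset ⟨hx, fun y hy => h ▸ hvmax.2 y hy⟩)
  simpa using hlt

theorem IsVertexOf.exists_finset_sub_mem_hull (hv : IsVertexOf P v) (hP : IsConvexPolyhedron P) :
    ∃ (T : Finset (Fin n → ℝ)) (l : StrongDual ℝ (Fin n → ℝ)), (∀ t ∈ T, l t = 1) ∧
      (∀ t ∈ T, ∃ c : ℝ, 0 < c ∧ v + c • t ∈ P) ∧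
      ∀ x ∈ P, x - v ∈ PointedCone.hull ℝ (T : Set (Fin n → ℝ)) := by
  classical
  obtain ⟨l, hl⟩ := hv.exists_pos
  obtain ⟨S, hSP, -, hPS⟩ := hP.exists_finset_sub_mem_hull hv.mem
  let p : (Fin n → ℝ) → Fin n → ℝ := fun s => (l (s - v))⁻¹ • (s - v)
  have hSl : ∀ s ∈ S.erase v, s ∈ P ∧ 0 < l (s - v) := fun s hs =>
    have hsP := hSP (subset_convexHull ℝ _ (mem_coe.2 (mem_of_mem_erase hs)))
    ⟨hsP, hl s hsP (ne_of_mem_erase hs)⟩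
  have hp : ∀ s ∈ S.erase v, l (s - v) • p s = s - v := fun s hs => by
    simp only [p, smul_smul, mul_inv_cancel₀ (hSl s hs).2.ne', one_smul]
  refine ⟨(S.erase v).image p, l, forall_mem_image.2 fun s hs => ?_,
    forall_mem_image.2 fun s hs => ⟨l (s - v), (hSl s hs).2, ?_⟩, fun x hx => ?_⟩
  · simp only [p, map_smul, smul_eq_mul, inv_mul_cancel₀ (hSl s hs).2.ne']
  · simpa only [hp s hs, add_sub_cancel] using (hSl s hs).1
  · refine Submodule.span_le.2 ?_ (hPS x hx)
    rintro _ ⟨s, hs, rfl⟩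
    rcases eq_or_ne s v with rfl | hsv
    · simp
    · have hsS : s ∈ S.erase v := mem_erase.2 ⟨hsv, hs⟩
      beta_reduce
      rw [← hp s hsS]
      exact PointedCone.smul_mem _ (hSl s hsS).2.le
        (PointedCone.subset_hull (mem_coe.2 (mem_image_of_mem p hsS)))

theorem IsVertexOf.sub_mem_of_forall_edge (hv : IsVertexOf P v) (hP : IsConvexPolyhedron P)
    {C : PointedCone ℝ (Fin n → ℝ)} (hC : ∀ E ∈ edgesAt P v, ∀ x ∈ E, x - v ∈ C) {x : Fin n → ℝ}
    (hx : x ∈ P) : x - v ∈ C := by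
  obtain ⟨T, l, hl, hTP, hPT⟩ := hv.exists_finset_sub_mem_hull hP
  refine hull_le_of_forall_exposed hl (fun e he h hhe hh => ?_) (hPT x hx)
  have hhT : ∀ t ∈ (T : Set (Fin n → ℝ)), h t ≤ 0 := fun t ht => by
    rcases eq_or_ne t e with rfl | hte
    exacts [hhe.le, (hh t ht hte).le]
  have hsep : {t ∈ (T : Set (Fin n → ℝ)) | h t = 0} = {e} := Set.ext fun t =>
    ⟨fun ht => by_contra fun hte => (hh t ht.1 hte).ne ht.2, fun hte => hte ▸ ⟨he, hhe⟩⟩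
  have hdim : affDim (h.toExposed P) = 1 := by
    rw [affDim, vectorSpan_toExposed hv.mem hPT hTP hhT, hsep, finrank_span_singleton]
    rintro rfl
    simpa using hl _ he
  have hmem := fun y => mem_toExposed_iff_sub_mem_hull (x := y) hv.mem hPT hhT
  have hvE : v ∈ h.toExposed P := (hmem v).2 ⟨hv.mem, by simp⟩
  obtain ⟨c, hc, hce⟩ := hTP e he
  have hcE : v + c • e ∈ h.toExposed P := (hmem _).2 ⟨hce, by
    rw [hsep, add_sub_cancel_left]
    exact PointedCone.smul_mem _ hc.le (PointedCone.subset_hull rfl)⟩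
  have heC := PointedCone.smul_mem _ (inv_nonneg.2 hc.le)
    (hC _ ⟨⟨⟨v, hvE⟩, ContinuousLinearMap.toExposed.isExposed, hdim⟩, hvE⟩ _ hcE)
  rwa [add_sub_cancel_left, smul_smul, inv_mul_cancel₀ hc.ne', one_smul] at heC

end Polyhedron

section Edges

variable {n : ℕ} {P E : Set (Fin n → ℝ)} {v : Fin n → ℝ} {r : Fin n → ℤ}

theorem intPt_sub (a b : Fin n → ℤ) : intPt (a - b) = intPt a - intPt b := by
  ext i; simp [intPt]

theorem intPt_zsmul (c : ℤ) (a : Fin n → ℤ) : intPt (c • a) = c • intPt a := by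
  ext i; simp [intPt]

theorem IsPrimitiveVec.intPt_ne_zero (hr : IsPrimitiveVec r) : intPt r ≠ 0 := by
  intro h
  have hzero : ∀ i, r i = 0 := fun i => by simpa [intPt] using congrFun h i
  rw [IsPrimitiveVec, Finset.gcd_eq_zero_iff.2 fun i _ => hzero i] at hr
  exact zero_ne_one hr

theorem IsPrimitiveVec.units_smul (hr : IsPrimitiveVec r) (u : ℤˣ) : IsPrimitiveVec (u • r) := by
  have hgcd : Finset.univ.gcd (u • r) = Finset.univ.gcd r :=
    dvd_antisymm_of_normalize_eq Finset.normalize_gcd Finset.normalize_gcd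
      (Finset.gcd_mono_fun fun i _ => by simp [Units.smul_def])
      (Finset.gcd_mono_fun fun i _ => by simp [Units.smul_def])
  rwa [IsPrimitiveVec, hgcd]

theorem IsPrimitiveVec.exists_int_eq {z : Fin n → ℤ} (hr : IsPrimitiveVec r) {t : ℝ}
    (h : t • intPt r = intPt z) : ∃ k : ℤ, t = k := by
  obtain ⟨f, hf⟩ := Finset.gcd_eq_sum_mul Finset.univ r
  have hone : (1 : ℝ) = ∑ i, (r i : ℝ) * f i := by
    exact_mod_cast hr.symm.trans hf
  have hz : ∀ i, t * r i = z i := fun i => by simpa [intPt] using congrFun h i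
  refine ⟨∑ i, z i * f i, ?_⟩
  push_cast
  simp only [← hz, mul_assoc, ← Finset.mul_sum, ← hone, mul_one]

theorem IsIntegerConvexPolyhedron.add_intPt_mem (hP : IsIntegerConvexPolyhedron P)
    (hv : v ∈ intLattice n) (hvP : v ∈ P) (hr : IsPrimitiveVec r) (hE : IsExtreme ℝ P E)
    (hEr : ∀ x ∈ E, ∃ c : ℝ, 0 ≤ c ∧ v + c • intPt r = x)
    (hrE : ∀ c : ℝ, v + c • intPt r ∈ P → v + c • intPt r ∈ E) (hEv : ¬ E ⊆ {v}) :
    v + intPt r ∈ P := by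
  classical
  -- Otherwise `E` is a segment shorter than `r`, whose far end is a non-integral vertex of `P`.
  by_contra hnot
  have hlt : ∀ c : ℝ, v + c • intPt r ∈ P → c < 1 := fun c hc => by
    by_contra! h
    refine hnot ?_
    have := hP.1.1.add_smul_mem hvP hc (t := c⁻¹) ⟨by positivity, inv_le_one_of_one_le₀ h⟩
    rwa [smul_smul, inv_mul_cancel₀ (by positivity), one_smul] at this
  obtain ⟨S, hS⟩ := hP.1.2 {v, v + intPt r}
  have hES : E = convexHull ℝ (S : Set (Fin n → ℝ)) := by
    rw [← hS, coe_insert, coe_singleton, convexHull_pair, segment_eq_image']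
    ext x
    constructor
    · intro hx
      obtain ⟨c, hc, rfl⟩ := hEr x hx
      exact ⟨hE.subset hx, c, ⟨hc, (hlt c (hE.subset hx)).le⟩, by simp⟩
    · rintro ⟨hx, c, -, rfl⟩
      simp only [add_sub_cancel_left] at hx ⊢
      exact hrE c hx
  have hextreme : E.extremePoints ℝ ⊆ {v} := fun x hx => by
    have hxP := hE.extremePoints_subset_extremePoints hx
    obtain ⟨c, hc, rfl⟩ := hEr x hx.1
    obtain ⟨z, hz⟩ := hP.2 _ (hP.1.isVertexOf_of_mem_extremePoints hxP)
    obtain ⟨y, rfl⟩ := hv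
    obtain ⟨k, rfl⟩ := hr.exists_int_eq (z := z - y) (t := c) (by rw [intPt_sub, hz]; simp)
    have hk : k < 1 := by exact_mod_cast hlt k hxP.1
    have hk0 : 0 ≤ k := by exact_mod_cast hc
    obtain rfl : k = 0 := by omega
    simp
  refine hEv ?_
  have hcompact : IsCompact E := hES ▸ S.finite_toSet.isCompact_convexHull ℝ
  rw [← closure_convexHull_extremePoints hcompact (hES ▸ convex_convexHull ℝ _)]
  exact closure_minimal (convexHull_min hextreme (convex_singleton v)) isClosed_singleton

theorem IsVertexOf.exists_units_smul (hv : IsVertexOf P v) (hE : E ⊆ P) {w : Fin n → ℝ}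
    (hw : ∀ x ∈ E, ∃ t : ℝ, v + t • w = x) :
    ∃ u : ℤˣ, ∀ x ∈ E, ∃ c : ℝ, 0 ≤ c ∧ v + c • u • w = x := by
  obtain ⟨l, hl⟩ := hv.exists_pos
  have hsign : ∀ t : ℝ, v + t • w ∈ E → v + t • w = v ∨ 0 < t * l w := fun t ht =>
    or_iff_not_imp_left.2 fun hne => by simpa using hl _ (hE ht) hne
  rcases le_total 0 (l w) with hlw | hlw
  · refine ⟨1, fun x hx => ?_⟩
    obtain ⟨t, rfl⟩ := hw x hx
    rcases hsign t hx with h | h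
    · exact ⟨0, le_rfl, by simp [h]⟩
    · exact ⟨t, (pos_of_mul_pos_left h hlw).le, by simp⟩
  · refine ⟨-1, fun x hx => ?_⟩
    obtain ⟨t, rfl⟩ := hw x hx
    rcases hsign t hx with h | h
    · exact ⟨0, le_rfl, by simp [h]⟩
    · exact ⟨-t, (pos_of_mul_pos_left (b := -l w) (by simpa using h) (by simpa using hlw)).le,
        by simp [Units.smul_def]⟩

theorem exists_add_smul_eq_of_mem_edgesAt (hE : E ∈ edgesAt P v) {w : Fin n → ℝ}
    (hw : w ∈ vectorSpan ℝ E) (hw0 : w ≠ 0) {x : Fin n → ℝ} (hx : x ∈ E) :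
    ∃ t : ℝ, v + t • w = x := by
  have hspan : Submodule.span ℝ {w} = vectorSpan ℝ E :=
    Submodule.eq_of_le_of_finrank_eq (by simpa using hw)
      ((finrank_span_singleton hw0).trans hE.1.2.2.symm)
  obtain ⟨t, ht⟩ := Submodule.mem_span_singleton.1 (hspan ▸ vsub_mem_vectorSpan ℝ hx hE.2)
  exact ⟨t, by simp [ht]⟩

theorem add_smul_mem_of_mem_edgesAt (hE : E ∈ edgesAt P v) {w : Fin n → ℝ}
    (hw : w ∈ vectorSpan ℝ E) {t : ℝ} (ht : v + t • w ∈ P) : v + t • w ∈ E := by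
  obtain ⟨l, rfl⟩ := hE.1.2.1 ⟨v, hE.2⟩
  exact mem_toExposed_of_sub_mem_vectorSpan hE.2 ht (by
    rw [add_sub_cancel_left]
    exact Submodule.smul_mem _ t hw)

theorem IsVertexOf.exists_units_smul_of_isPrimitiveDirection (hv : IsVertexOf P v)
    (hP : IsIntegerConvexPolyhedron P) (hE : E ∈ edgesAt P v) (hr : IsPrimitiveDirection E r) :
    ∃ u : ℤˣ, v + intPt (u • r) ∈ P ∧
      ∀ x ∈ E, x - v ∈ PointedCone.hull ℝ {intPt (u • r)} := by
  obtain ⟨u, hu⟩ := hv.exists_units_smul hE.1.2.1.subset fun x hx =>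
    exists_add_smul_eq_of_mem_edgesAt hE hr.2 hr.1.intPt_ne_zero hx
  have hur : intPt (u • r) = u • intPt r := intPt_zsmul _ _
  have hspan : intPt (u • r) ∈ vectorSpan ℝ E := by
    rw [hur]
    exact zsmul_mem hr.2 _
  simp only [← hur] at hu
  refine ⟨u, hP.add_intPt_mem (hP.2 v hv) hv.mem (hr.1.units_smul u) hE.1.2.1.isExtreme hu
    (fun c => add_smul_mem_of_mem_edgesAt hE hspan) fun hEv => ?_, fun x hx => ?_⟩
  · have hdim : affDim E = 1 := hE.1.2.2
    rw [affDim, vectorSpan_of_subsingleton ℝ (Set.subsingleton_singleton.anti hEv)] at hdim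
    simp at hdim
  · obtain ⟨c, hc, rfl⟩ := hu x hx
    rw [add_sub_cancel_left]
    exact PointedCone.smul_mem _ hc (PointedCone.subset_hull rfl)

theorem IsVertexOf.exists_units_smul_sub_mem_hull (hv : IsVertexOf P v)
    (hP : IsIntegerConvexPolyhedron P) {ι : Type*} {E : ι → edgesAt P v}
    (hE : Function.Surjective E) {r : ι → Fin n → ℤ}
    (hr : ∀ i, IsPrimitiveDirection (E i : Set (Fin n → ℝ)) (r i)) :
    ∃ u : ι → ℤˣ, (∀ i, v + intPt (u i • r i) ∈ P) ∧
      ∀ x ∈ P, x - v ∈ PointedCone.hull ℝ (Set.range fun i => intPt (u i • r i)) := by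
  choose u huP hu using fun i =>
    hv.exists_units_smul_of_isPrimitiveDirection hP (E i).2 (hr i)
  refine ⟨u, huP, fun x hx => hv.sub_mem_of_forall_edge hP.1 (fun e he y hy => ?_) hx⟩
  obtain ⟨i, hi⟩ := hE ⟨e, he⟩
  have hy' : y ∈ (E i : Set (Fin n → ℝ)) := hi ▸ hy
  exact Submodule.span_mono (by simp) (hu i y hy')

end Edges

section LatticeFree

theorem one_sub_sum_div_one_add_sum {ι : Type*} {s : Finset ι} {d : ι → ℝ}
    (h : 1 + ∑ a ∈ s, d a ≠ 0) :
    1 - ∑ a ∈ s, d a / (1 + ∑ a ∈ s, d a) = 1 / (1 + ∑ a ∈ s, d a) := by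
  rw [← sum_div, eq_div_iff h, sub_mul, div_mul_cancel₀ _ h]
  ring

section

variable {V : Type*} [AddCommGroup V] [Module ℝ V] {P : Set V} {v : V}

theorem mem_convexHull_union_zero (hP : Convex ℝ P) (hne : P.Nonempty) {y : V} :
    y ∈ convexHull ℝ (P ∪ {0}) ↔ ∃ a ∈ Set.Icc (0 : ℝ) 1, ∃ x ∈ P, a • x = y := by
  rw [Set.union_singleton, convexHull_insert hne, hP.convexHull_eq, mem_convexJoin]
  simp only [Set.mem_singleton_iff, exists_eq_left, segment_eq_image, Set.mem_image, smul_zero,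
    zero_add]
  exact ⟨fun ⟨x, hx, a, ha, h⟩ => ⟨a, ha, x, hx, h⟩, fun ⟨a, ha, x, hx, h⟩ => ⟨x, hx, a, ha, h⟩⟩

theorem HasNatApprox.exists_smul_eq_sub_sum (hP : Convex ℝ P) {t : Finset V}
    (ht : ∀ a ∈ t, v + a ∈ P) {d : V → ℝ} (hd : ∀ a ∈ t, 0 ≤ d a) (hdv : ∑ a ∈ t, d a • a = v)
    (h : HasNatApprox t fun a => d a / (1 + ∑ a ∈ t, d a)) :
    ∃ k : V → ℕ, (∃ a ∈ t, k a ≠ 0) ∧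
      ∃ γ ∈ Set.Ioc (0 : ℝ) 1, ∃ p ∈ P, γ • p = v - ∑ a ∈ t, k a • a := by
  obtain ⟨k, hk, hkle, hlt⟩ := h
  have hL : 0 < 1 + ∑ a ∈ t, d a := add_pos_of_pos_of_nonneg one_pos (sum_nonneg hd)
  set L := 1 + ∑ a ∈ t, d a with hLdef
  set N : ℝ := ((∑ a ∈ t, k a : ℕ) : ℝ) with hN
  let c : V → ℝ := fun a => (N + 1) * (d a / L) - k a
  have hc : ∀ a ∈ t, 0 ≤ c a := fun a ha => sub_nonneg.2 (hkle a ha)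
  have hcsum : ∑ a ∈ t, c a = 1 - (N + 1) / L := by
    have hd' : ∑ a ∈ t, d a = L - 1 := by rw [hLdef]; ring
    simp only [c, sum_sub_distrib, ← mul_sum, ← sum_div, hd']
    rw [← Nat.cast_sum, ← hN]
    field_simp
    ring
  rw [one_sub_sum_div_one_add_sum hL.ne', mul_one_div] at hlt
  have hpos : 0 < ∑ a ∈ t, c a := by linarith
  refine ⟨k, exists_ne_zero_of_sum_ne_zero (by omega), ∑ a ∈ t, c a, ⟨hpos, ?_⟩,
    t.centerMass c fun a => v + a, hP.centerMass_mem hc hpos ht, ?_⟩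
  · have : 0 ≤ (N + 1) / L := by positivity
    linarith
  · have hsum : ∑ a ∈ t, c a • a = ((N + 1) / L) • v - ∑ a ∈ t, k a • a := by
      have hcoef : ∀ a, (N + 1) * (d a / L) = (N + 1) / L * d a := fun a => by ring
      simp only [c, hcoef, sub_smul, sum_sub_distrib, mul_smul, ← smul_sum, hdv,
        Nat.cast_smul_eq_nsmul]
    rw [centerMass, smul_smul, mul_inv_cancel₀ hpos.ne', one_smul]
    simp only [smul_add, sum_add_distrib, ← sum_smul, hsum, hcsum]
    module

end

section

variable {V : Type*} [AddCommGroup V] [Module ℝ V] [TopologicalSpace V] [ContinuousAdd V]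
  [ContinuousSMul ℝ V] {P : Set V} {v : V}

theorem mem_of_mem_interior_convexHull_union_zero (hP : Convex ℝ P) (hv : v ∈ P)
    (hvint : v ∈ interior (convexHull ℝ (P ∪ {0}))) {C : PointedCone ℝ V}
    (hC : ∀ x ∈ P, x - v ∈ C) : v ∈ C := by
  obtain ⟨t, ⟨ht, -⟩, htP⟩ := exists_add_smul_mem (mem_interior_iff_mem_nhds.1 hvint) v
  obtain ⟨a, ⟨ha, ha1⟩, x, hx, hax⟩ := (mem_convexHull_union_zero hP ⟨v, hv⟩).1 htP
  have hpos : 0 < 1 + t - a := by linarith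
  have hva : (1 + t - a) • v = a • (x - v) := by
    rw [smul_sub, hax]
    module
  have hmem : (1 + t - a) • v ∈ C := hva ▸ PointedCone.smul_mem _ ha (hC x hx)
  simpa [smul_smul, inv_mul_cancel₀ hpos.ne'] using
    PointedCone.smul_mem C (inv_nonneg.2 hpos.le) hmem

theorem apply_neg_of_mem_interior_convexHull_union_zero (hP : Convex ℝ P) (hv : v ∈ P)
    (hvint : v ∈ interior (convexHull ℝ (P ∪ {0}))) {l : StrongDual ℝ V} (hl : l ≠ 0)
    (hmax : ∀ x ∈ P, l x ≤ l v) : l v < 0 := by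
  obtain ⟨d, hd⟩ : ∃ d, 0 < l d := by
    by_contra! hcon
    exact hl (ContinuousLinearMap.ext fun x =>
      (hcon x).antisymm (by simpa using hcon (-x)))
  obtain ⟨t, ⟨ht, -⟩, htP⟩ := exists_add_smul_mem (mem_interior_iff_mem_nhds.1 hvint) d
  obtain ⟨a, ⟨ha, ha1⟩, x, hx, hax⟩ := (mem_convexHull_union_zero hP ⟨v, hv⟩).1 htP
  have hlx : a * l x = l v + t * l d := by simpa using congrArg l hax
  have htd : 0 < t * l d := mul_pos ht hd
  have hax' : a * l x ≤ a * l v := mul_le_mul_of_nonneg_left (hmax x hx) ha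
  by_contra! hcon
  linarith [mul_le_of_le_one_left hcon ha1]

end

section

variable {n : ℕ} {P : Set (Fin n → ℝ)} {v : Fin n → ℝ} {t : Finset (Fin n → ℝ)}
  {d : (Fin n → ℝ) → ℝ}

theorem IsVertexOf.sub_sum_nsmul_notMem (hv : IsVertexOf P v)
    (ht : ∀ a ∈ t, v + a ∈ P ∧ a ≠ 0) {k : (Fin n → ℝ) → ℕ} (hk : ∃ a ∈ t, k a ≠ 0) :
    v - ∑ a ∈ t, k a • a ∉ P := by
  obtain ⟨l, hl⟩ := hv.exists_pos
  have hla : ∀ a ∈ t, 0 < l a := fun a ha => by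
    simpa using hl _ (ht a ha).1 (by simpa using (ht a ha).2)
  have hpos : 0 < l (∑ a ∈ t, k a • a) := by
    obtain ⟨a, ha, hka⟩ := hk
    rw [map_sum]
    simp only [map_nsmul]
    exact sum_pos' (fun b hb => nsmul_nonneg (hla b hb).le _) ⟨a, ha, nsmul_pos (hla a ha) hka⟩
  intro hmem
  have hne : v - ∑ a ∈ t, k a • a ≠ v := fun h => by
    rw [sub_eq_self] at h
    rw [h, map_zero] at hpos
    exact hpos.false
  have := hl _ hmem hne
  rw [sub_sub_cancel_left, map_neg] at this
  linarith

theorem IsVertexOf.not_hasNatApprox (hv : IsVertexOf P v) (hP : Convex ℝ P)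
    (hvZ : v ∈ intLattice n) (hempty : (intLattice n ∩ convexHull ℝ (P ∪ {0})) \ P = {0})
    (htZ : ∀ a ∈ t, a ∈ intLattice n) (ht : ∀ a ∈ t, v + a ∈ P ∧ a ≠ 0)
    (hd : ∀ a ∈ t, 0 ≤ d a) (hdv : ∑ a ∈ t, d a • a = v) :
    ¬ HasNatApprox t fun a => d a / (1 + ∑ a ∈ t, d a) := fun h => by
  obtain ⟨k, hk, γ, ⟨hγ, hγ1⟩, p, hp, hγp⟩ :=
    h.exists_smul_eq_sub_sum hP (fun a ha => (ht a ha).1) hd hdv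
  have hZ : v - ∑ a ∈ t, k a • a ∈ ((Int.castAddHom ℝ).compLeft (Fin n)).range :=
    sub_mem hvZ (sum_mem fun a ha => nsmul_mem (htZ a ha) _)
  have hhull : v - ∑ a ∈ t, k a • a ∈ convexHull ℝ (P ∪ {0}) :=
    (mem_convexHull_union_zero hP ⟨v, hv.mem⟩).2 ⟨γ, ⟨hγ.le, hγ1⟩, p, hp, hγp⟩
  have hzero : v - ∑ a ∈ t, k a • a = 0 :=
    hempty.subset ⟨⟨hZ, hhull⟩, hv.sub_sum_nsmul_notMem ht hk⟩
  obtain rfl : p = 0 := (smul_eq_zero.1 (hγp.trans hzero)).resolve_left hγ.ne'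
  exact (hempty.superset rfl).2 hp

theorem IsVertexOf.sum_lt_pow_factorial (hn : 2 ≤ n) (hv : IsVertexOf P v) (hP : Convex ℝ P)
    (hvZ : v ∈ intLattice n) (hempty : (intLattice n ∩ convexHull ℝ (P ∪ {0})) \ P = {0})
    (htZ : ∀ a ∈ t, a ∈ intLattice n) (ht : ∀ a ∈ t, v + a ∈ P)
    (hti : LinearIndepOn ℝ id (t : Set (Fin n → ℝ)))
    (hd : ∀ a ∈ t, 0 ≤ d a) (hdv : ∑ a ∈ t, d a • a = v) :
    ∑ a ∈ t, d a < (n : ℝ) ^ (4 * n.factorial) := by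
  rcases t.eq_empty_or_nonempty with rfl | htne
  · simp only [sum_empty]
    positivity
  have hcard : #t ≤ n := by
    simpa using LinearIndependent.fintype_card_le_finrank hti
  have hL : 0 < 1 + ∑ a ∈ t, d a := add_pos_of_pos_of_nonneg one_pos (sum_nonneg hd)
  by_contra! hbig
  refine hv.not_hasNatApprox hP hvZ hempty htZ (fun a ha => ⟨ht a ha, hti.ne_zero ha⟩) hd hdv
    (hasNatApprox_of_sum_near_one hn htne hcard (fun a ha => div_nonneg (hd a ha) hL.le) ?_ ?_)
  · rw [← sum_div, div_le_one hL]
    linarith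
  · have hpow : (n : ℝ) ^ (4 * (#t).factorial) ≤ n ^ (4 * n.factorial) := by
      gcongr
      exact_mod_cast (by omega : 1 ≤ n)
    rw [one_sub_sum_div_one_add_sum hL.ne']
    exact one_div_lt_one_div_of_lt (by positivity) (by linarith)

end

end LatticeFree

section Determinant

theorem enatCard_quotient_le_natAbs {G : Type*} [AddCommGroup G] (ψ : G →+ ℤ) {z : G}
    (hz : ψ z ≠ 0) {L : AddSubgroup G} (hL : ∀ w, ψ w = ψ z → w ∈ L) :
    ENat.card (G ⧸ L) ≤ (ψ z).natAbs := by
  have : NeZero (ψ z).natAbs := ⟨Int.natAbs_ne_zero.2 hz⟩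
  let φ : G →+ ZMod (ψ z).natAbs := (Int.castAddHom _).comp ψ
  have hker : φ.ker ≤ L := fun w hw => by
    obtain ⟨c, hc⟩ : ψ z ∣ ψ w := by
      rwa [← Int.natAbs_dvd, ← ZMod.intCast_zmod_eq_zero_iff_dvd]
    have hshift : w - c • z + z ∈ L := hL _ (by simp [hc, mul_comm])
    have hzL : z ∈ L := hL z rfl
    simpa using L.add_mem (L.sub_mem hshift hzL) (L.zsmul_mem hzL c)
  have hdvd : L.index ∣ Nat.card φ.range :=
    AddSubgroup.index_ker φ ▸ AddSubgroup.index_dvd_of_le hker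
  have : L.FiniteIndex := ⟨ne_zero_of_dvd_ne_zero Nat.card_pos.ne' hdvd⟩
  have hcard : Nat.card φ.range ≤ (ψ z).natAbs :=
    (Nat.card_le_card_of_injective _ Subtype.val_injective).trans_eq (Nat.card_zmod _)
  rw [ENat.card_eq_coe_natCard]
  exact_mod_cast (Nat.le_of_dvd Nat.card_pos hdvd).trans hcard

section

variable {R : Type*} [CommRing R] {k : ℕ} {b : Fin k → Fin (k + 1) → R} {w : Fin (k + 1) → R}

/-- The determinant of the square matrix with first row `w` and remaining rows `b`, as a linear
functional of `w`: its kernel is the hyperplane spanned by the rows `b` when they are independent,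
so that its absolute value measures the distance to that hyperplane. -/
def detCons (b : Fin k → Fin (k + 1) → R) : (Fin (k + 1) → R) →ₗ[R] R :=
  (Matrix.detRowAlternating (R := R)).toMultilinearMap.toLinearMap (Fin.cons 0 b) 0

theorem detCons_apply :
    detCons b w = (Matrix.of (Fin.cons w b : Fin (k + 1) → Fin (k + 1) → R)).det := by
  simp only [detCons, MultilinearMap.toLinearMap_apply, Fin.update_cons_zero]
  rfl

theorem detCons_ne_zero_iff {K : Type*} [Field K] {b : Fin k → Fin (k + 1) → K}
    {w : Fin (k + 1) → K} :
    detCons b w ≠ 0 ↔ LinearIndependent K b ∧ w ∉ Submodule.span K (Set.range b) := by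
  rw [detCons_apply, ← isUnit_iff_ne_zero, ← Matrix.isUnit_iff_isUnit_det,
    ← Matrix.linearIndependent_rows_iff_isUnit, ← linearIndependent_finCons]
  rfl

theorem detCons_intPt (b : Fin k → Fin (k + 1) → ℤ) (w : Fin (k + 1) → ℤ) :
    detCons (fun j => intPt (b j)) (intPt w) = (detCons b w : ℝ) := by
  rw [detCons_apply, detCons_apply, Int.cast_det]
  congr 1
  ext i j
  refine Fin.cases rfl (fun i => rfl) i

theorem abs_detCons_sum_smul_le {b : Fin k → Fin (k + 1) → ℝ} {t : Finset (Fin (k + 1) → ℝ)}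
    {d : (Fin (k + 1) → ℝ) → ℝ} (hd : ∀ a ∈ t, 0 ≤ d a) {D : ℝ}
    (hD : ∀ a ∈ t, |detCons b a| ≤ D) :
    |detCons b (∑ a ∈ t, d a • a)| ≤ (∑ a ∈ t, d a) * D := by
  rw [map_sum, sum_mul]
  refine (abs_sum_le_sum_abs _ _).trans (sum_le_sum fun a ha => ?_)
  rw [map_smul, smul_eq_mul, abs_mul, abs_of_nonneg (hd a ha)]
  exact mul_le_mul_of_nonneg_left (hD a ha) (hd a ha)

theorem integerDistance_zero_le_natAbs_detCons {F : Set (Fin (k + 1) → ℝ)}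
    {z : Fin (k + 1) → ℤ} (hz : intPt z ∈ F) {b : Fin k → Fin (k + 1) → ℤ}
    (hb : Submodule.span ℝ (Set.range fun j => intPt (b j)) = vectorSpan ℝ F)
    (hdet : detCons b z ≠ 0) : integerDistance F 0 ≤ (detCons b z).natAbs := by
  refine enatCard_quotient_le_natAbs (detCons b).toAddMonoidHom hdet fun w hw =>
    AddSubgroup.subset_closure ?_
  have hind : LinearIndependent ℝ fun j => intPt (b j) :=
    (detCons_ne_zero_iff.1 ((detCons_intPt b z).trans_ne (Int.cast_ne_zero.2 hdet))).1
  have hzero : detCons (fun j => intPt (b j)) (intPt (w - z)) = 0 := by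
    rw [detCons_intPt, map_sub, Int.cast_eq_zero, sub_eq_zero]
    exact hw
  have hmem : intPt (w - z) ∈ vectorSpan ℝ F := by
    rw [← hb]
    by_contra hnot
    exact detCons_ne_zero_iff.2 ⟨hind, hnot⟩ hzero
  have hspan := AffineSubspace.vadd_mem_of_mem_direction
    ((direction_affineSpan ℝ F).symm ▸ hmem) (mem_affineSpan ℝ hz)
  simpa [intPt_sub] using hspan

end

section

variable {n m : ℕ}

theorem natAbs_det_le_edgeStarDet (r : Fin m → Fin n → ℤ) (g : Fin n → Fin m) :
    (Matrix.of fun j => r (g j)).det.natAbs ≤ edgeStarDet r := by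
  by_cases hg : Function.Injective g
  · let i : Fin n ↪o Fin m := OrderEmbedding.ofStrictMono (g ∘ Tuple.sort g)
      ((Tuple.monotone_sort g).strictMono_of_injective (hg.comp (Tuple.sort g).injective))
    have hperm : (Matrix.of fun j => r (i j)) =
        (Matrix.of fun j => r (g j)).submatrix (Tuple.sort g) id := rfl
    calc (Matrix.of fun j => r (g j)).det.natAbs
        = (Matrix.of fun j => r (i j)).det.natAbs := by
          rw [hperm, Matrix.det_permute, Int.natAbs_mul, Int.cast_id, Int.units_natAbs, one_mul]
      _ ≤ edgeStarDet r :=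
          single_le_sum (f := fun i : Fin n ↪o Fin m => (Matrix.of fun j => r (i j)).det.natAbs)
            (fun _ _ => Nat.zero_le _) (mem_univ i)
  · obtain ⟨a, b, hab, hne⟩ := Function.not_injective_iff.1 hg
    rw [Matrix.det_zero_of_row_eq hne (by ext c; simp [hab])]
    simp

theorem edgeStarDet_units_smul (r : Fin m → Fin n → ℤ) (u : Fin m → ℤˣ) :
    edgeStarDet (fun i => u i • r i) = edgeStarDet r := by
  refine sum_congr rfl fun i _ => ?_
  have hmul : (Matrix.of fun j => u (i j) • r (i j)) =
      Matrix.of fun a b => ((u (i a) : ℤˣ) : ℤ) * (Matrix.of fun j => r (i j)) a b := rfl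
  have hunit : (∏ j, ((u (i j) : ℤˣ) : ℤ)).natAbs = 1 :=
    Int.isUnit_iff_natAbs_eq.1 (IsUnit.prod_univ_iff.2 fun j => (u (i j)).isUnit)
  rw [hmul, Matrix.det_mul_column, Int.natAbs_mul, hunit, one_mul]

theorem natAbs_detCons_le_edgeStarDet {k : ℕ} (r : Fin m → Fin (k + 1) → ℤ) (f : Fin k → Fin m)
    (i : Fin m) : (detCons (fun j => r (f j)) (r i)).natAbs ≤ edgeStarDet r := by
  have hcons : (Fin.cons (r i) fun j => r (f j) : Fin (k + 1) → Fin (k + 1) → ℤ) =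
      fun j => r ((Fin.cons i f : Fin (k + 1) → Fin m) j) :=
    funext (Fin.cases rfl fun _ => rfl)
  rw [detCons_apply, hcons]
  exact natAbs_det_le_edgeStarDet r _

theorem le_of_edgeStarDet_ne_zero {r : Fin m → Fin n → ℤ} (h : edgeStarDet r ≠ 0) : n ≤ m := by
  obtain ⟨i, -, -⟩ := exists_ne_zero_of_sum_ne_zero h
  simpa using Fintype.card_le_of_embedding i.toEmbedding

theorem pow_mul_edgeStarDet_le (r : Fin m → Fin n → ℤ) (N : ℕ) :
    n ^ N * edgeStarDet r ≤ (n * m) ^ N * edgeStarDet r := by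
  rcases eq_or_ne (edgeStarDet r) 0 with h | h
  · simp [h]
  · have hnm : n ≤ m := le_of_edgeStarDet_ne_zero h
    gcongr
    exact (Nat.le_mul_self n).trans (Nat.mul_le_mul_left n hnm)

end

end Determinant

section Facet

variable {n k : ℕ} {P F : Set (Fin n → ℝ)} {v : Fin n → ℝ}

theorem IsFaceOfDim.exists_linearIndependent_span_eq (hF : IsFaceOfDim P F k) (hvF : v ∈ F)
    {ι : Type*} {q : ι → Fin n → ℝ} (hq : ∀ i, v + q i ∈ P)
    (hPq : ∀ x ∈ P, x - v ∈ PointedCone.hull ℝ (Set.range q)) :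
    ∃ f : Fin k → ι, (LinearIndependent ℝ fun j => q (f j)) ∧
      Submodule.span ℝ (Set.range fun j => q (f j)) = vectorSpan ℝ F := by
  obtain ⟨l, rfl⟩ := hF.2.1 hF.1
  have hl : ∀ t ∈ Set.range q, l t ≤ 0 :=
    Set.forall_mem_range.2 fun i => by simpa using hvF.2 _ (hq i)
  have hspan := vectorSpan_toExposed (l := l) hvF.1 hPq
    (Set.forall_mem_range.2 fun i => ⟨1, one_pos, by simpa using hq i⟩) hl
  obtain rfl : Module.finrank ℝ (Submodule.span ℝ {t ∈ Set.range q | l t = 0}) = k :=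
    hspan ▸ hF.2.2
  obtain ⟨g, hgq, hgspan, hg⟩ := Submodule.exists_fun_fin_finrank_span_eq ℝ
    {t ∈ Set.range q | l t = 0}
  choose f hf using fun j => (hgq j).1
  obtain rfl : (fun j => q (f j)) = g := funext hf
  exact ⟨f, hg, hgspan.trans hspan.symm⟩

theorem IsFaceOfDim.notMem_vectorSpan (hF : IsFaceOfDim P F k) (hk : k < affDim P)
    (hP : Convex ℝ P) (hvF : v ∈ F) (hvint : v ∈ interior (convexHull ℝ (P ∪ {0}))) :
    v ∉ vectorSpan ℝ F := by
  obtain ⟨l, rfl⟩ := hF.2.1 hF.1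
  have hl : l ≠ 0 := by
    rintro rfl
    have hall : (0 : StrongDual ℝ (Fin n → ℝ)).toExposed P = P := by
      ext x
      simp [ContinuousLinearMap.toExposed]
    exact hk.ne' ((congrArg affDim hall).symm.trans hF.2.2)
  exact fun hmem => (apply_neg_of_mem_interior_convexHull_union_zero hP hvF.1 hvint hl hvF.2).ne
    (apply_eq_zero_of_mem_vectorSpan_toExposed hmem)

end Facet

theorem IsVertexOf.natAbs_detCons_lt {k m : ℕ} (hk : 2 ≤ k + 1) {P : Set (Fin (k + 1) → ℝ)}
    {z : Fin (k + 1) → ℤ} (hz : IsVertexOf P (intPt z)) (hP : Convex ℝ P)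
    (hint : intPt z ∈ interior (convexHull ℝ (P ∪ {0})))
    (hempty : (intLattice (k + 1) ∩ convexHull ℝ (P ∪ {0})) \ P = {0})
    {q : Fin m → Fin (k + 1) → ℤ} (hq : ∀ i, intPt z + intPt (q i) ∈ P)
    (hPq : ∀ x ∈ P, x - intPt z ∈ PointedCone.hull ℝ (Set.range fun i => intPt (q i)))
    {f : Fin k → Fin m} (hdet : detCons (fun j => q (f j)) z ≠ 0) :
    (detCons (fun j => q (f j)) z).natAbs <
      (k + 1) ^ (4 * (k + 1).factorial) * edgeStarDet q := by
  obtain ⟨t, htq, hti, hzt⟩ := exists_linearIndepOn_mem_hull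
    (mem_of_mem_interior_convexHull_union_zero hP hz.mem hint hPq)
  obtain ⟨d, hd, hdz⟩ := mem_hull_finset.1 hzt
  have htP : ∀ a ∈ t, intPt z + a ∈ P := fun a ha => by
    obtain ⟨i, rfl⟩ := htq ha
    exact hq i
  have hsum : ∑ a ∈ t, d a < ((k + 1 : ℕ) : ℝ) ^ (4 * (k + 1).factorial) :=
    hz.sum_lt_pow_factorial hk hP ⟨z, rfl⟩ hempty
      (fun a ha => Set.range_comp_subset_range q intPt (htq ha)) htP hti hd hdz
  have hD : ∀ a ∈ t, |detCons (fun j => intPt (q (f j))) a| ≤ edgeStarDet q := fun a ha => by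
    obtain ⟨i, rfl⟩ := htq ha
    rw [detCons_intPt, ← Int.cast_abs, Int.abs_eq_natAbs]
    exact_mod_cast natAbs_detCons_le_edgeStarDet q f i
  have hle := abs_detCons_sum_smul_le hd hD
  rw [hdz, detCons_intPt, ← Int.cast_abs, Int.abs_eq_natAbs, Int.cast_natCast] at hle
  have hpos : 0 < (edgeStarDet q : ℝ) := Nat.cast_pos.2 <| Nat.pos_of_ne_zero fun h => by
    rw [h, Nat.cast_zero, mul_zero] at hle
    exact hdet (by simpa using hle.antisymm (Nat.cast_nonneg _))
  exact_mod_cast hle.trans_lt (mul_lt_mul_of_pos_right hsum hpos)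

theorem theorem6_general (n : ℕ) (hn : 2 ≤ n)
    (P : Set (Fin n → ℝ)) (hP : IsIntegerConvexPolyhedron P) (hdim : affDim P = n)
    (v : Fin n → ℝ) (hv : IsVertexOf P v)
    (hvint : v ∈ interior (convexHull ℝ (P ∪ {0})))
    (m : ℕ) (E : Fin m → edgesAt P v) (hE : Function.Surjective E)
    (r : Fin m → Fin n → ℤ) (hr : ∀ i, IsPrimitiveDirection (E i : Set (Fin n → ℝ)) (r i))
    (F : Set (Fin n → ℝ)) (hF : IsFaceOfDim P F (n - 1)) (hvF : v ∈ F)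
    (hempty : (intLattice n ∩ convexHull ℝ (P ∪ {0})) \ P = {0}) :
    integerDistance F 0 < ((n ^ (4 * n.factorial) * edgeStarDet r : ℕ) : ℕ∞) := by
  obtain ⟨k, rfl⟩ : ∃ k, n = k + 1 := ⟨n - 1, by omega⟩
  obtain ⟨u, huP, huC⟩ := hv.exists_units_smul_sub_mem_hull hP hE hr
  obtain ⟨f, hf, hfF⟩ := hF.exists_linearIndependent_span_eq hvF huP huC
  have hvspan := hF.notMem_vectorSpan (by omega) hP.1.1 hvF hvint
  obtain ⟨z, rfl⟩ := hP.2 v hv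
  have hdet : detCons (fun j => u (f j) • r (f j)) z ≠ 0 := by
    rw [← Int.cast_ne_zero (α := ℝ), ← detCons_intPt]
    exact detCons_ne_zero_iff.2 ⟨hf, hfF ▸ hvspan⟩
  rw [← edgeStarDet_units_smul r u]
  exact (integerDistance_zero_le_natAbs_detCons hvF hfF hdet).trans_lt
    (Nat.cast_lt.2 (hv.natAbs_detCons_lt hn hP.1.1 hvint hempty huP huC hdet))

theorem theorem6 (n : ℕ) (hn : 2 ≤ n)
    (P : Set (Fin n → ℝ)) (hP : IsIntegerConvexPolyhedron P) (hdim : affDim P = n)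
    (hP0 : (0 : Fin n → ℝ) ∉ P)
    (v : Fin n → ℝ) (hv : IsVertexOf P v)
    (hvint : v ∈ interior (convexHull ℝ (P ∪ {0})))
    (m : ℕ) (E : Fin m ≃ edgesAt P v)
    (r : Fin m → Fin n → ℤ) (hr : ∀ i, IsPrimitiveDirection (E i : Set (Fin n → ℝ)) (r i))
    (F : Set (Fin n → ℝ)) (hF : IsFaceOfDim P F (n - 1)) (hvF : v ∈ F)
    (hempty : (intLattice n ∩ convexHull ℝ (P ∪ {0})) \ P = {0}) :
    integerDistance F 0 < (((n * m) ^ (4 * n.factorial) * edgeStarDet r : ℕ) : ℕ∞) :=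
  (theorem6_general n hn P hP hdim v hv hvint m E E.surjective r hr F hF hvF hempty).trans_le
    (Nat.cast_le.2 (pow_mul_edgeStarDet_le r _))
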